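/- Let $m\ge 0$ be an integer, let $\|\cdot\|$ be the Euclidean norm on $\mathbb{R}^m$, let $Y$ be an arbitrary set, and let $v\colon Y\to\mathbb{R}^m$ be an arbitrary map. Let $A\subset Y$ and let $u\colon A\to\mathbb{R}^m$ satisfy $$\|u(x)-u(y)\|\le\|v(x)-v(y)\|\qquad\text{for all }x,y\in A.$$ Then there exists a map $\tilde u\colon Y\to\mathbb{R}^m$ with $\tilde u(x)=u(x)$ for all $x\in A$ such that $$\|\tilde u(x)-\tilde u(y)\|\le\|v(x)-v(y)\|\qquad\text{for all }x,y\in Y,$$ and such that, for every real number $\delta\ge 0$, if $\|v(x)-u(x)\|\le\delta$ for all $x\in A$, then $\|v(x)-\tilde u(x)\|\le\delta$ for all $x\in Y$. -/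

import Mathlib

open Set

/-! By Zorn, it suffices to extend by one point `p`: the balls around `b i` of radius `‖p - a i‖`
and the ball around `p` of radius `δ` must meet. For finitely many balls, a minimax argument turns
this into an inequality for weighted variances of the centres. That inequality follows from
comparing pairwise distances and from `‖∑ w i • (a i - b i)‖ ≤ (∑ w i) * δ`. Compactness gives
infinite families. -/

theorem sum_mul_norm_sub_sq {E ι : Type*} [NormedAddCommGroup E] [InnerProductSpace ℝ E]
    [Fintype ι] (w : ι → ℝ) (c : ι → E) (q : E) :
    ∑ i, w i * ‖q - c i‖ ^ 2 =
      (∑ i, w i) * ‖q‖ ^ 2 - 2 * inner ℝ q (∑ i, w i • c i) + ∑ i, w i * ‖c i‖ ^ 2 := by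
  rw [inner_sum, Finset.mul_sum, Finset.sum_mul, ← Finset.sum_sub_distrib,
    ← Finset.sum_add_distrib]
  refine Finset.sum_congr rfl fun i _ => ?_
  rw [norm_sub_sq_real, inner_smul_right]
  ring

/-- Expresses the weighted variance through pairwise distances alone, the only data that the
nonexpansiveness hypothesis compares. -/
theorem sum_sum_mul_norm_sub_sq {E ι : Type*} [NormedAddCommGroup E] [InnerProductSpace ℝ E]
    [Fintype ι] (w : ι → ℝ) (c : ι → E) :
    ∑ i, w i * ∑ j, w j * ‖c i - c j‖ ^ 2 =
      2 * ((∑ i, w i) * ∑ i, w i * ‖c i‖ ^ 2 - ‖∑ i, w i • c i‖ ^ 2) := by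
  have h : ∀ i, w i * ∑ j, w j * ‖c i - c j‖ ^ 2 =
      (∑ j, w j) * (w i * ‖c i‖ ^ 2) - 2 * inner ℝ (w i • c i) (∑ j, w j • c j)
        + w i * ∑ j, w j * ‖c j‖ ^ 2 := fun i => by
    rw [sum_mul_norm_sub_sq, inner_smul_left]
    simp only [conj_trivial]
    ring
  simp_rw [h]
  rw [Finset.sum_add_distrib, Finset.sum_sub_distrib, ← Finset.mul_sum, ← Finset.mul_sum,
    ← Finset.sum_mul, ← sum_inner, real_inner_self_eq_norm_sq]
  ring

/-- A minimax criterion for finitely many closed balls to have a common point. -/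
theorem exists_forall_norm_sub_sq_le {E ι : Type*} [NormedAddCommGroup E]
    [InnerProductSpace ℝ E] [Fintype ι] [Nonempty ι] (c : ι → E) (r : ι → ℝ)
    (h : ∀ w ∈ stdSimplex ℝ ι,
      ∑ i, w i * ‖c i‖ ^ 2 - ‖∑ i, w i • c i‖ ^ 2 ≤ ∑ i, w i * r i) :
    ∃ q, ∀ i, ‖q - c i‖ ^ 2 ≤ r i := by
  classical
  let f : E → (ι → ℝ) → ℝ := fun q w => ∑ i, w i * (‖q - c i‖ ^ 2 - r i)
  have hne : (stdSimplex ℝ ι).Nonempty :=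
    ⟨Pi.single (Classical.arbitrary ι) 1, single_mem_stdSimplex ℝ _⟩
  have hconv : ∀ w ∈ stdSimplex ℝ ι, ConvexOn ℝ (convexHull ℝ (range c)) fun q => f q w := by
    intro w hw
    refine ConvexOn.subset (t := univ) ?_ (subset_univ _) (convex_convexHull ℝ _)
    have hi : ∀ i, ConvexOn ℝ univ fun q : E => w i * (‖q - c i‖ ^ 2 - r i) := fun i => by
      have h1 : ConvexOn ℝ univ fun q : E => ‖q - c i‖ := by
        simpa [dist_eq_norm] using convexOn_univ_dist (E := E) (c i)
      have h2 := (h1.pow (fun _ _ => norm_nonneg _) 2).add_const (-r i)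
      simpa [sub_eq_add_neg] using h2.smul (hw.1 i)
    refine ⟨convex_univ, fun x hx y hy a b ha hb hab => ?_⟩
    simp only [f, Finset.smul_sum, ← Finset.sum_add_distrib]
    exact Finset.sum_le_sum fun i _ => (hi i).2 hx hy ha hb hab
  have hconc : ∀ q ∈ convexHull ℝ (range c), ConcaveOn ℝ (stdSimplex ℝ ι) (f q) := by
    intro q _
    refine ⟨convex_stdSimplex ℝ ι, fun x _ y _ a b _ _ _ => le_of_eq ?_⟩
    simp only [f, smul_eq_mul, Pi.add_apply, Pi.smul_apply, Finset.mul_sum,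
      ← Finset.sum_add_distrib]
    exact Finset.sum_congr rfl fun i _ => by ring
  -- At a saddle point `(q, w)`, the value at `q` and any vertex of the simplex is at most the value
  -- at `w` and the `w`-mean of the centres, which `h` makes nonpositive.
  obtain ⟨q, -, w, hw, hqw⟩ := Sion.exists_isSaddlePointOn'
    (X := convexHull ℝ (range c)) (Y := stdSimplex ℝ ι) (f := f)
    (range_nonempty c).convexHull
    ((finite_range c).isCompact_convexHull ℝ)
    (fun w _ =>
      (show Continuous fun q => f q w by fun_prop).lowerSemicontinuous.lowerSemicontinuousOn _)
    (fun w hw => (hconv w hw).quasiconvexOn) (convex_stdSimplex ℝ ι)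
    (isCompact_stdSimplex ℝ ι)
    (fun q _ =>
      (show Continuous (f q) by fun_prop).upperSemicontinuous.upperSemicontinuousOn _)
    (fun q hq => (hconc q hq).quasiconcaveOn) (convex_convexHull ℝ _) hne
  refine ⟨q, fun i => ?_⟩
  have hmem : ∑ i, w i • c i ∈ convexHull ℝ (range c) :=
    (convex_convexHull ℝ _).sum_mem (fun i _ => hw.1 i) hw.2
      fun i _ => subset_convexHull ℝ _ (mem_range_self i)
  have h1 := hqw _ hmem _ (single_mem_stdSimplex ℝ i)
  have h2 : f (∑ i, w i • c i) w ≤ 0 := by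
    have h3 := h w hw
    simp only [f, mul_sub, Finset.sum_sub_distrib]
    rw [sum_mul_norm_sub_sq, hw.2, real_inner_self_eq_norm_sq]
    linarith
  have h4 : f q (Pi.single i 1) = ‖q - c i‖ ^ 2 - r i := by
    simp [f, Pi.single_apply]
  linarith

/-- Finite one-point extension of a nonexpansive correspondence `a i ↦ b i` to the point `0`. -/
theorem exists_norm_sub_le_and_norm_le {E ι : Type*} [NormedAddCommGroup E]
    [InnerProductSpace ℝ E] [Fintype ι] (a b : ι → E) {δ : ℝ} (hδ : 0 ≤ δ)
    (hab : ∀ i j, ‖b i - b j‖ ≤ ‖a i - a j‖) (hd : ∀ i, ‖a i - b i‖ ≤ δ) :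
    ∃ q, (∀ i, ‖q - b i‖ ≤ ‖a i‖) ∧ ‖q‖ ≤ δ := by
  -- The index `none` stands for the extra ball of radius `δ` around `0`.
  suffices h : ∀ w ∈ stdSimplex ℝ (Option ι), ∑ o, w o * ‖o.elim 0 b‖ ^ 2
      - ‖∑ o, w o • o.elim 0 b‖ ^ 2 ≤ ∑ o, w o * o.elim (δ ^ 2) fun i => ‖a i‖ ^ 2 by
    obtain ⟨q, hq⟩ := exists_forall_norm_sub_sq_le _ _ h
    refine ⟨q, fun i => ?_, ?_⟩
    · exact le_of_sq_le_sq (hq (some i)) (norm_nonneg _)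
    · have hq0 := hq none
      simp only [Option.elim_none, sub_zero] at hq0
      exact le_of_sq_le_sq hq0 hδ
  intro w' hw'
  obtain ⟨w, hw⟩ : ∃ w : ι → ℝ, w = fun i => w' (some i) := ⟨_, rfl⟩
  have hw0 : ∀ i, 0 ≤ w i := fun i => hw ▸ hw'.1 _
  have hsum := hw'.2
  have ht := hw'.1 none
  simp only [Fintype.sum_option, Option.elim_none, Option.elim_some, norm_zero, smul_zero,
    zero_add] at hsum ⊢
  simp only [← congrFun hw] at hsum ⊢
  generalize w' none = t at *
  have hs0 : 0 ≤ ∑ i, w i := Finset.sum_nonneg fun i _ => hw0 i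
  have key : ∑ i, w i * ∑ j, w j * ‖b i - b j‖ ^ 2 ≤ ∑ i, w i * ∑ j, w j * ‖a i - a j‖ ^ 2 := by
    gcongr with i _ j _
    · exact hw0 i
    · exact hw0 j
    · exact hab i j
  rw [sum_sum_mul_norm_sub_sq, sum_sum_mul_norm_sub_sq] at key
  have hG : ‖∑ i, w i • a i - ∑ i, w i • b i‖ ≤ (∑ i, w i) * δ := by
    rw [← Finset.sum_sub_distrib, Finset.sum_mul]
    refine norm_sum_le_of_le _ fun i _ => ?_
    rw [← smul_sub, norm_smul, Real.norm_of_nonneg (hw0 i)]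
    exact mul_le_mul_of_nonneg_left (hd i) (hw0 i)
  -- If `s = 0`, all the weight sits on the extra ball; otherwise one may divide by `s`.
  rcases hs0.eq_or_lt with hs | hs
  · have hz : ∀ i, w i = 0 := fun i =>
      (Finset.sum_eq_zero_iff_of_nonneg fun i _ => hw0 i).1 hs.symm i (Finset.mem_univ i)
    simp only [hz]
    simp only [zero_mul, zero_smul, Finset.sum_const_zero, norm_zero]
    have := mul_nonneg ht (sq_nonneg δ)
    linarith
  generalize ∑ i, w i • a i = A at *
  generalize ∑ i, w i • b i = B at *
  generalize ∑ i, w i = s at *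
  -- With `t = 1 - s`, it remains to show `t‖B‖² - ‖A‖² ≤ s t δ²`. This comes from `t‖A - B‖² - ‖A -
  -- tB‖² = s (t‖B‖² - ‖A‖²)`, where the inner products cancel.
  have hG2 : t * ‖A - B‖ ^ 2 ≤ t * (s * δ) ^ 2 := by gcongr
  have hsq : ‖A - t • B‖ ^ 2 = ‖A‖ ^ 2 - 2 * (t * inner ℝ A B) + t ^ 2 * ‖B‖ ^ 2 := by
    rw [norm_sub_sq_real, inner_smul_right, norm_smul, mul_pow, Real.norm_eq_abs, sq_abs]
  rw [norm_sub_sq_real] at hG2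
  have hnn := sq_nonneg ‖A - t • B‖
  obtain rfl : t = 1 - s := by linarith
  have h1 : s * (s * ((1 - s) * ‖B‖ ^ 2 - ‖A‖ ^ 2)) ≤ s * (s * (s * ((1 - s) * δ ^ 2))) := by
    refine mul_le_mul_of_nonneg_left ?_ hs.le
    linarith
  have h2 := le_of_mul_le_mul_left (le_of_mul_le_mul_left h1 hs) hs
  refine le_of_mul_le_mul_left ?_ hs
  linarith

/-- One-point extension of a nonexpansive correspondence `a i ↦ b i` to the point `p`, preserving
every bound on the displacement. -/
theorem exists_norm_sub_le_and_displacement_le {E ι : Type*} [NormedAddCommGroup E]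
    [InnerProductSpace ℝ E] [ProperSpace E] [Nonempty ι] (a b : ι → E) (p : E)
    (hab : ∀ i j, ‖b i - b j‖ ≤ ‖a i - a j‖) :
    ∃ q, (∀ i, ‖q - b i‖ ≤ ‖p - a i‖) ∧ ∀ δ, (∀ i, ‖a i - b i‖ ≤ δ) → ‖p - q‖ ≤ δ := by
  classical
  obtain ⟨i₀⟩ := ‹Nonempty ι›
  let C : ι → Set E := fun i => Metric.closedBall (b i) ‖p - a i‖ ∩
    ⋂ δ ∈ {δ | ∀ i, ‖a i - b i‖ ≤ δ}, Metric.closedBall p δ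
  obtain ⟨q, -, hq⟩ := (isCompact_closedBall (b i₀) ‖p - a i₀‖).inter_iInter_nonempty C
    (fun i => Metric.isClosed_closedBall.inter
      (isClosed_biInter fun _ _ => Metric.isClosed_closedBall)) fun F => by
    have hF : (insert i₀ F).Nonempty := Finset.insert_nonempty _ _
    -- The largest displacement in the finite subfamily lies below every admissible `δ`, so this
    -- single radius handles all of them.
    obtain ⟨k, -, hk⟩ := (insert i₀ F).exists_max_image (fun i => ‖a i - b i‖) hF
    obtain ⟨q, hq, hqδ⟩ := exists_norm_sub_le_and_norm_le
      (fun i : (insert i₀ F : Finset ι) => a i - p) (fun i => b i - p)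
      (norm_nonneg (a k - b k)) (fun i j => by simpa using hab i j)
      (fun i => by simpa using hk i i.2)
    have hb : ∀ i ∈ insert i₀ F, q + p ∈ Metric.closedBall (b i) ‖p - a i‖ := fun i hi => by
      rw [mem_closedBall_iff_norm, norm_sub_rev p, ← sub_sub_eq_add_sub]
      exact hq ⟨i, hi⟩
    refine ⟨q + p, hb i₀ (Finset.mem_insert_self _ _), ?_⟩
    simp only [mem_iInter]
    refine fun i hi => ⟨hb i (Finset.mem_insert_of_mem hi), ?_⟩
    simp only [mem_iInter]
    intro δ hδ
    simpa using hqδ.trans (hδ k)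
  simp only [mem_iInter, C, mem_inter_iff] at hq
  refine ⟨q, fun i => mem_closedBall_iff_norm.1 (hq i).1, fun δ hδ => ?_⟩
  rw [norm_sub_rev]
  exact mem_closedBall_iff_norm.1 ((hq i₀).2 δ hδ)

/-- Kirszbraun extension preserving every bound on the displacement. -/
theorem exists_extension_displacement_le {Y E : Type*} [NormedAddCommGroup E]
    [InnerProductSpace ℝ E] [ProperSpace E] (v : Y → E)
    (A : Set Y) (u : A → E)
    (huv : ∀ x y : A, ‖u x - u y‖ ≤ ‖v x - v y‖) :
    ∃ u' : Y → E,
      (∀ x : A, u' x = u x) ∧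
      (∀ x y : Y, ‖u' x - u' y‖ ≤ ‖v x - v y‖) ∧
      (∀ δ : ℝ, 0 ≤ δ → (∀ x : A, ‖v x - u x‖ ≤ δ) → ∀ x : Y, ‖v x - u' x‖ ≤ δ) := by
  rcases A.eq_empty_or_nonempty with rfl | ⟨x₀, hx₀⟩
  · exact ⟨v, fun x => x.2.elim, fun _ _ => le_rfl, fun δ hδ _ x => by simpa using hδ⟩
  -- Relations suffice: the first condition forces single-valuedness, since `‖v x - v x‖ = 0`. As
  -- `A` is nonempty here, every admissible `δ` is automatically nonnegative.
  let S : Set (Set (Y × E)) :=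
    {G | (∀ g ∈ G, ∀ h ∈ G, ‖g.2 - h.2‖ ≤ ‖v g.1 - v h.1‖) ∧
      ∀ δ : ℝ, (∀ x : A, ‖v x - u x‖ ≤ δ) → ∀ g ∈ G, ‖v g.1 - g.2‖ ≤ δ}
  obtain ⟨G, hG, hmax⟩ := zorn_subset_nonempty S (fun c hc hchain _ => by
    refine ⟨⋃₀ c, ⟨?_, ?_⟩, fun s => subset_sUnion_of_mem⟩
    · rintro g ⟨s, hs, hgs⟩ h ⟨t, ht, hht⟩
      rcases hchain.total hs ht with hst | hts
      · exact (hc ht).1 g (hst hgs) h hht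
      · exact (hc hs).1 g hgs h (hts hht)
    · rintro δ hδ g ⟨s, hs, hgs⟩
      exact (hc hs).2 δ hδ g hgs) (range fun x : A => ((x : Y), u x)) (by
    constructor
    · rintro _ ⟨x, rfl⟩ _ ⟨y, rfl⟩
      exact huv x y
    · rintro δ hδ _ ⟨x, rfl⟩
      exact hδ x)
  have hGS : G ∈ S := hmax.prop
  have hdom : ∀ y, ∃ q, (y, q) ∈ G := fun y => by
    have : Nonempty G := ⟨⟨_, hG ⟨⟨x₀, hx₀⟩, rfl⟩⟩⟩
    obtain ⟨q, hq, hqδ⟩ := exists_norm_sub_le_and_displacement_le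
      (fun g : G => v g.1.1) (fun g : G => g.1.2) (v y) fun g h => hGS.1 g g.2 h h.2
    have hins : insert (y, q) G ∈ S := by
      constructor
      · rintro g (rfl | hg) h (rfl | hh)
        · simp
        · exact hq ⟨h, hh⟩
        · rw [norm_sub_rev, norm_sub_rev (v g.1)]
          exact hq ⟨g, hg⟩
        · exact hGS.1 g hg h hh
      · rintro δ hδ g (rfl | hg)
        · exact hqδ δ fun g => hGS.2 δ hδ g g.2
        · exact hGS.2 δ hδ g hg
    exact ⟨q, hmax.le_of_ge hins (subset_insert _ _) (mem_insert _ _)⟩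
  choose u' hu' using hdom
  refine ⟨u', fun x => ?_, fun x y => hGS.1 _ (hu' x) _ (hu' y),
    fun δ _ hδ x => hGS.2 δ hδ _ (hu' x)⟩
  have h := hGS.1 _ (hu' x) _ (hG ⟨x, rfl⟩)
  simp only [sub_self, norm_zero, norm_le_zero_iff] at h
  exact sub_eq_zero.1 h

theorem mainTheorem5 {Y : Type*} (m : ℕ) (v : Y → EuclideanSpace ℝ (Fin m))
    (A : Set Y) (u : A → EuclideanSpace ℝ (Fin m))
    (huv : ∀ x y : A, ‖u x - u y‖ ≤ ‖v x - v y‖) :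
    ∃ u' : Y → EuclideanSpace ℝ (Fin m),
      (∀ x : A, u' x = u x) ∧
      (∀ x y : Y, ‖u' x - u' y‖ ≤ ‖v x - v y‖) ∧
      (∀ δ : ℝ, 0 ≤ δ → (∀ x : A, ‖v x - u x‖ ≤ δ) → ∀ x : Y, ‖v x - u' x‖ ≤ δ) := by
  exact exists_extension_displacement_le v A u huv
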